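/- Let $\mathcal H$ be a complex Hilbert space with scalar product $\langle\cdot,\cdot\rangle$ linear in the second argument, let $A$ be a (possibly unbounded) self-adjoint operator in $\mathcal H$, let $\langle A\rangle=(1+A^2)^{1/2}$, let $H_b$ be a bounded self-adjoint operator on $\mathcal H$, let $I\subset\mathbb R$ be a bounded interval and let $s\ge 0$. Let $(f_n,z_n)_n$ be a special sequence for $H_b$ associated to $(I,s,A)$, that is, a sequence in $\mathcal H\times\mathbb C$ such that, for some $\lambda\in I$ and some $\eta\ge 0$: $\operatorname{Re} z_n\in I$ for all $n$ and $\operatorname{Re} z_n\to\lambda$; $\operatorname{Im} z_n\ne 0$ for all $n$ and $\operatorname{Im} z_n\to 0$; $\|\langle A\rangle^{-s}f_n\|\to\eta$; $(H_b-z_n)f_n$ belongs to the domain $\mathcal D(\langle A\rangle^{s})$ for all $n$, and $\|\langle A\rangle^{s}(H_b-z_n)f_n\|\to 0$. Then, for every bounded Borel function $\varphi:\mathbb R\to\mathbb C$, with $\varphi(A)$ defined by the Borel functional calculus, $$\lim_{n\to\infty}\langle f_n,[H_b,\varphi(A)]f_n\rangle=0,\qquad [H_b,\varphi(A)]=H_b\varphi(A)-\varphi(A)H_b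 .$$ -/

import Mathlib

open MeasureTheory Filter Topology
open scoped NNReal ENNReal

/-- A projection-valued measure (resolution of the identity) on the Borel sets of `ℝ`, acting in
the complex Hilbert space `H`. By convention its value on non-measurable sets is `0`. -/
structure ProjValuedMeasure (H : Type*) [NormedAddCommGroup H] [InnerProductSpace ℂ H]
    [CompleteSpace H] where
  /-- the projection attached to a set -/
  proj : Set ℝ → H →L[ℂ] H
  isStarProjection : ∀ S, MeasurableSet S → IsStarProjection (proj S)
  proj_of_not_measurable : ∀ S, ¬ MeasurableSet S → proj S = 0
  proj_univ : proj Set.univ = 1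
  proj_inter : ∀ S T, MeasurableSet S → MeasurableSet T → proj (S ∩ T) = proj S * proj T
  hasSum_iUnion : ∀ S : ℕ → Set ℝ, (∀ n, MeasurableSet (S n)) → Pairwise (Function.onFun Disjoint S) →
    ∀ x : H, HasSum (fun n => proj (S n) x) (proj (⋃ n, S n) x)

namespace ProjValuedMeasure

variable {H : Type*} [NormedAddCommGroup H] [InnerProductSpace ℂ H] [CompleteSpace H]

theorem proj_empty (E : ProjValuedMeasure H) : E.proj ∅ = 0 := by
  ext x
  have h := E.hasSum_iUnion (fun _ => ∅) (fun _ => MeasurableSet.empty)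
    (fun _ _ _ => disjoint_bot_left) x
  have h2 := (summable_const_iff _).1 h.summable
  simpa using h2

theorem inner_proj_proj (E : ProjValuedMeasure H) {S T : Set ℝ} (hS : MeasurableSet S)
    (hT : MeasurableSet T) (x : H) :
    inner ℂ (E.proj S x) (E.proj T x) = inner ℂ x (E.proj (S ∩ T) x) := by
  rw [E.proj_inter S T hS hT, mul_apply_eq_comp]
  have h := (E.isStarProjection S hS).isSelfAdjoint
  rw [ContinuousLinearMap.isSelfAdjoint_iff'] at h
  conv_lhs => rw [← h]
  rw [ContinuousLinearMap.adjoint_inner_left]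

theorem inner_proj_self (E : ProjValuedMeasure H) {S : Set ℝ} (hS : MeasurableSet S) (x : H) :
    inner ℂ x (E.proj S x) = ((‖E.proj S x‖ ^ 2 : ℝ) : ℂ) := by
  have h := E.inner_proj_proj hS hS x
  rw [Set.inter_self, inner_self_eq_norm_sq_to_K] at h
  rw [← h]
  simp

theorem proj_union (E : ProjValuedMeasure H) {S T : Set ℝ} (hS : MeasurableSet S)
    (hT : MeasurableSet T) (hST : Disjoint S T) (x : H) :
    E.proj (S ∪ T) x = E.proj S x + E.proj T x := by
  let U : ℕ → Set ℝ := fun n => if n = 0 then S else if n = 1 then T else ∅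
  have hU : ∀ n, MeasurableSet (U n) := by
    intro n
    simp only [U]
    split_ifs
    exacts [hS, hT, MeasurableSet.empty]
  have hd : Pairwise (Function.onFun Disjoint U) := by
    intro m n hmn
    simp only [U, Function.onFun]
    split_ifs <;> first | omega | simp [hST.symm]
  have hUn : ⋃ n, U n = S ∪ T := by
    ext t
    simp only [Set.mem_iUnion, Set.mem_union, U]
    constructor
    · rintro ⟨n, hn⟩
      split_ifs at hn
      exacts [Or.inl hn, Or.inr hn, hn.elim]
    · rintro (h | h)
      · exact ⟨0, by simpa using h⟩
      · exact ⟨1, by simpa using h⟩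
  have h := E.hasSum_iUnion U hU hd x
  rw [hUn] at h
  refine h.unique ?_
  have h2 := hasSum_sum_of_ne_finset_zero (f := fun n => E.proj (U n) x) (s := Finset.range 2)
    (L := SummationFilter.unconditional ℕ)
    (by
      intro n hn
      have : 1 < n := by simpa using hn
      have h0 : U n = ∅ := by simp only [U]; rw [if_neg (by omega), if_neg (by omega)]
      simp [h0, E.proj_empty])
  simpa [Finset.sum_range_succ, U] using h2

/-- The scalar spectral measure `S ↦ ⟨x, E(S) x⟩ = ‖E(S) x‖²` of the vector `x`. -/
noncomputable def scalarMeasure (E : ProjValuedMeasure H) (x : H) : Measure ℝ :=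
  Measure.ofMeasurable (fun S _ => ENNReal.ofReal (‖E.proj S x‖ ^ 2))
    (by simp [E.proj_empty])
    (by
      intro S hS hd
      have h := (innerSL ℂ x).hasSum (E.hasSum_iUnion S hS hd x)
      simp only [innerSL_apply_apply, E.inner_proj_self (MeasurableSet.iUnion hS)] at h
      have h' : HasSum (fun n => ‖E.proj (S n) x‖ ^ 2) (‖E.proj (⋃ n, S n) x‖ ^ 2) := by
        have h2 := Complex.hasSum_re h
        simp only [Complex.ofReal_re,
          fun n => E.inner_proj_self (hS n)] at h2
        exact h2
      rw [← h'.tsum_eq, ENNReal.ofReal_tsum_of_nonneg (fun n => by positivity) h'.summable])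

theorem scalarMeasure_apply (E : ProjValuedMeasure H) (x : H) {S : Set ℝ} (hS : MeasurableSet S) :
    E.scalarMeasure x S = ENNReal.ofReal (‖E.proj S x‖ ^ 2) :=
  Measure.ofMeasurable_apply S hS

theorem scalarMeasure_univ (E : ProjValuedMeasure H) (x : H) :
    E.scalarMeasure x Set.univ = ENNReal.ofReal (‖x‖ ^ 2) := by
  simp [E.scalarMeasure_apply x MeasurableSet.univ, E.proj_univ]

instance (E : ProjValuedMeasure H) (x : H) : IsFiniteMeasure (E.scalarMeasure x) :=
  ⟨by rw [scalarMeasure_univ]; exact ENNReal.ofReal_lt_top⟩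

theorem scalarMeasure_zero (E : ProjValuedMeasure H) : E.scalarMeasure 0 = 0 := by
  ext S hS
  simp [E.scalarMeasure_apply _ hS]

theorem scalarMeasure_smul (E : ProjValuedMeasure H) (c : ℂ) (x : H) :
    E.scalarMeasure (c • x) = ENNReal.ofReal (‖c‖ ^ 2) • E.scalarMeasure x := by
  ext S hS
  simp only [E.scalarMeasure_apply _ hS, Measure.smul_apply, smul_eq_mul, map_smul, norm_smul]
  rw [mul_pow, ENNReal.ofReal_mul (by positivity)]

theorem scalarMeasure_add_le (E : ProjValuedMeasure H) (x y : H) :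
    E.scalarMeasure (x + y) ≤ 2 • (E.scalarMeasure x + E.scalarMeasure y) := by
  refine Measure.le_iff.2 fun S hS => ?_
  simp only [E.scalarMeasure_apply _ hS, Measure.smul_apply, Measure.add_apply, map_add]
  rw [← ENNReal.ofReal_add (by positivity) (by positivity), ← ENNReal.ofReal_nsmul]
  apply ENNReal.ofReal_le_ofReal
  have h1 := norm_add_le (E.proj S x) (E.proj S y)
  have h2 := norm_nonneg (E.proj S x + E.proj S y)
  simp only [nsmul_eq_mul, Nat.cast_ofNat]
  nlinarith [sq_nonneg (‖E.proj S x‖ - ‖E.proj S y‖)]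

/-- The integral `∫ s dE = ∑ c E({s = c})` of a simple function. -/
noncomputable def simpleIntegral (E : ProjValuedMeasure H) (s : SimpleFunc ℝ ℂ) : H →L[ℂ] H :=
  ∑ c ∈ s.range, c • E.proj (s ⁻¹' {c})

theorem simpleIntegral_sub (E : ProjValuedMeasure H) (s t : SimpleFunc ℝ ℂ) (x : H) :
    E.simpleIntegral (s - t) x = E.simpleIntegral s x - E.simpleIntegral t x := by
  let T : Set ℝ → ℂ →L[ℝ] H := fun S =>
    (ContinuousLinearMap.toSpanSingleton ℂ (E.proj S x)).restrictScalars ℝ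
  have hT : FinMeasAdditive (E.scalarMeasure x) T := by
    intro S S' hS hS' _ _ hd
    ext
    simp [T, E.proj_union hS hS' hd]
  have key : ∀ s : SimpleFunc ℝ ℂ, E.simpleIntegral s x = SimpleFunc.setToSimpleFunc T s := by
    intro s
    simp [simpleIntegral, SimpleFunc.setToSimpleFunc, T]
  have hi : ∀ s : SimpleFunc ℝ ℂ, Integrable s (E.scalarMeasure x) :=
    fun s => s.integrable_of_isFiniteMeasure
  rw [key, key, key, SimpleFunc.setToSimpleFunc_sub T hT (hi s) (hi t)]

theorem norm_simpleIntegral_sq (E : ProjValuedMeasure H) (s : SimpleFunc ℝ ℂ) (x : H) :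
    ‖E.simpleIntegral s x‖ ^ 2 = ∑ c ∈ s.range, ‖c‖ ^ 2 * ‖E.proj (s ⁻¹' {c}) x‖ ^ 2 := by
  have h : ((‖E.simpleIntegral s x‖ ^ 2 : ℝ) : ℂ)
      = ((∑ c ∈ s.range, ‖c‖ ^ 2 * ‖E.proj (s ⁻¹' {c}) x‖ ^ 2 : ℝ) : ℂ) := by
    have h0 := inner_self_eq_norm_sq_to_K (𝕜 := ℂ) (E.simpleIntegral s x)
    push_cast
    refine (Eq.symm h0).trans ?_
    simp only [simpleIntegral, _root_.sum_apply, _root_.smul_apply]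
    rw [sum_inner]
    refine Finset.sum_congr rfl fun c hc => ?_
    rw [inner_sum, Finset.sum_eq_single c]
    · rw [inner_smul_left, inner_smul_right, inner_self_eq_norm_sq_to_K, ← mul_assoc,
        Complex.conj_mul']
      rfl
    · intro d _ hdc
      rw [inner_smul_left, inner_smul_right, E.inner_proj_proj (s.measurableSet_fiber c)
        (s.measurableSet_fiber d)]
      have : s ⁻¹' {c} ∩ s ⁻¹' {d} = ∅ := by
        ext t
        simp only [Set.mem_inter_iff, Set.mem_preimage, Set.mem_singleton_iff,
          Set.mem_empty_iff_false, iff_false, not_and]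
        intro h1 h2
        exact hdc (h2.symm.trans h1)
      simp [this, E.proj_empty]
    · exact fun h => (h hc).elim
  exact_mod_cast h

theorem enorm_simpleIntegral (E : ProjValuedMeasure H) (s : SimpleFunc ℝ ℂ) (x : H) :
    ‖E.simpleIntegral s x‖ₑ = eLpNorm s 2 (E.scalarMeasure x) := by
  have h2 : (∫⁻ t, ‖s t‖ₑ ^ (2 : ℝ) ∂(E.scalarMeasure x)) = ‖E.simpleIntegral s x‖ₑ ^ (2 : ℝ) := by
    have h3 : (fun t => ‖s t‖ₑ ^ (2 : ℝ)) = (s.map fun c => ‖c‖ₑ ^ (2 : ℝ)) := rfl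
    rw [h3, SimpleFunc.lintegral_eq_lintegral, SimpleFunc.map_lintegral]
    have h4 : ∀ z : ℂ, ‖z‖ₑ ^ (2 : ℝ) = ENNReal.ofReal (‖z‖ ^ 2) := by
      intro z
      rw [← ofReal_norm, ENNReal.rpow_two, ENNReal.ofReal_pow (norm_nonneg _)]
    rw [← ofReal_norm, ENNReal.rpow_two, ← ENNReal.ofReal_pow (norm_nonneg _),
      norm_simpleIntegral_sq, ENNReal.ofReal_sum_of_nonneg (fun _ _ => by positivity)]
    refine Finset.sum_congr rfl fun c _ => ?_
    rw [h4, E.scalarMeasure_apply x (s.measurableSet_fiber c), ENNReal.ofReal_mul (by positivity)]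
  rw [eLpNorm_eq_lintegral_rpow_enorm_toReal (by norm_num) (by norm_num)]
  simp only [ENNReal.toReal_ofNat]
  rw [h2, ← ENNReal.rpow_mul]
  norm_num

/-- Simple functions converging pointwise to `φ`, and in `L²(μ)` for each `μ` with `φ ∈ L²(μ)`. -/
noncomputable def approx (φ : ℝ → ℂ) (hφ : Measurable φ) (n : ℕ) : SimpleFunc ℝ ℂ :=
  SimpleFunc.approxOn φ hφ Set.univ 0 (Set.mem_univ _) n

theorem tendsto_eLpNorm_approx {φ : ℝ → ℂ} (hφ : Measurable φ) {μ : Measure ℝ}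
    (h : MemLp φ 2 μ) :
    Tendsto (fun n => eLpNorm (⇑(approx φ hφ n) - φ) 2 μ) atTop (𝓝 0) :=
  SimpleFunc.tendsto_approxOn_Lp_eLpNorm hφ (Set.mem_univ _) (by norm_num) (by simp)
    (by simpa using h.2)

/-- The vector `∫ φ dE x`, i.e. the limit in `H` of the integrals of simple functions approximating
`φ` in `L²(E.scalarMeasure x)`; meaningful when `φ` is in that `L²` space. -/
noncomputable def integralVec (E : ProjValuedMeasure H) (φ : ℝ → ℂ) (hφ : Measurable φ) (x : H) :
    H :=
  limUnder atTop fun n => E.simpleIntegral (approx φ hφ n) x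

theorem tendsto_integralVec (E : ProjValuedMeasure H) {φ : ℝ → ℂ} (hφ : Measurable φ) {x : H}
    (h : MemLp φ 2 (E.scalarMeasure x)) :
    Tendsto (fun n => E.simpleIntegral (approx φ hφ n) x) atTop (𝓝 (E.integralVec φ hφ x)) := by
  refine tendsto_nhds_limUnder (cauchySeq_tendsto_of_complete ?_)
  rw [EMetric.cauchySeq_iff]
  intro ε hε
  have h1 := (tendsto_eLpNorm_approx hφ h).eventually (gt_mem_nhds (ENNReal.half_pos hε.ne'))
  obtain ⟨N, hN⟩ := eventually_atTop.1 h1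
  refine ⟨N, fun m hm n hn => ?_⟩
  rw [edist_eq_enorm_sub, ← E.simpleIntegral_sub, enorm_simpleIntegral]
  have h2 : (⇑(approx φ hφ m - approx φ hφ n) : ℝ → ℂ)
      = (⇑(approx φ hφ m) - φ) - (⇑(approx φ hφ n) - φ) := by
    ext t
    simp
  rw [h2]
  refine (eLpNorm_sub_le ?_ ?_ (by norm_num)).trans_lt
    ((ENNReal.add_lt_add (hN m hm) (hN n hn)).trans_le (ENNReal.add_halves ε).le)
  all_goals
    exact ((SimpleFunc.measurable _).sub hφ).aestronglyMeasurable

theorem enorm_integralVec (E : ProjValuedMeasure H) {φ : ℝ → ℂ} (hφ : Measurable φ) {x : H}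
    (h : MemLp φ 2 (E.scalarMeasure x)) :
    ‖E.integralVec φ hφ x‖ₑ = eLpNorm φ 2 (E.scalarMeasure x) := by
  have h1 := (E.tendsto_integralVec hφ h).enorm
  simp only [enorm_simpleIntegral] at h1
  refine tendsto_nhds_unique h1 ?_
  have h0 := tendsto_eLpNorm_approx hφ h
  have hm : ∀ n, AEStronglyMeasurable (⇑(approx φ hφ n)) (E.scalarMeasure x) :=
    fun n => (SimpleFunc.measurable _).aestronglyMeasurable
  have hm' : ∀ n, AEStronglyMeasurable (⇑(approx φ hφ n) - φ) (E.scalarMeasure x) :=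
    fun n => (hm n).sub h.1
  refine tendsto_of_tendsto_of_tendsto_of_le_of_le
    (g := fun n => eLpNorm φ 2 (E.scalarMeasure x)
      - eLpNorm (⇑(approx φ hφ n) - φ) 2 (E.scalarMeasure x))
    (h := fun n => eLpNorm φ 2 (E.scalarMeasure x)
      + eLpNorm (⇑(approx φ hφ n) - φ) 2 (E.scalarMeasure x)) ?_ ?_ ?_ ?_
  · simpa using ENNReal.Tendsto.sub tendsto_const_nhds h0 (Or.inr (by simp))
  · simpa using tendsto_const_nhds.add h0
  · intro n
    refine tsub_le_iff_right.2 ?_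
    have := eLpNorm_sub_le (hm n) (hm' n) (p := 2) (by norm_num)
    simpa using this
  · intro n
    have := eLpNorm_add_le h.1 (hm' n) (p := 2) (by norm_num)
    simpa using this

/-- The (possibly unbounded) normal operator `∫ φ dE`, with its natural domain
`{x | ∫ |φ|² d⟨x, E x⟩ < ∞}`. -/
noncomputable def integral (E : ProjValuedMeasure H) (φ : ℝ → ℂ) (hφ : Measurable φ) :
    H →ₗ.[ℂ] H where
  domain :=
    { carrier := {x | MemLp φ 2 (E.scalarMeasure x)}
      zero_mem' := by
        simp [scalarMeasure_zero]
      add_mem' := by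
        intro x y hx hy
        refine MemLp.mono_measure (E.scalarMeasure_add_le x y) ?_
        rw [two_nsmul]
        have h : MemLp φ 2 (E.scalarMeasure x + E.scalarMeasure y) := by
          refine ⟨hφ.aestronglyMeasurable, ?_⟩
          rw [eLpNorm_lt_top_iff_lintegral_rpow_enorm_lt_top (by norm_num) (by norm_num),
            lintegral_add_measure]
          exact ENNReal.add_lt_top.2
            ⟨(eLpNorm_lt_top_iff_lintegral_rpow_enorm_lt_top (by norm_num) (by norm_num)).1 hx.2,
              (eLpNorm_lt_top_iff_lintegral_rpow_enorm_lt_top (by norm_num) (by norm_num)).1 hy.2⟩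
        have h2 := h.smul_measure (c := 2) (by norm_num)
        rwa [two_smul] at h2
      smul_mem' := by
        intro c x hx
        simp only [Set.mem_ofPred_eq, scalarMeasure_smul]
        exact MemLp.smul_measure hx ENNReal.ofReal_ne_top }
  toFun :=
    { toFun := fun x => E.integralVec φ hφ x
      map_add' := by
        rintro ⟨x, hx⟩ ⟨y, hy⟩
        have hxy := Submodule.add_mem _ hx hy
        have h := (E.tendsto_integralVec hφ hx).add (E.tendsto_integralVec hφ hy)
        refine tendsto_nhds_unique (E.tendsto_integralVec hφ hxy) ?_
        simpa using h
      map_smul' := by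
        rintro c ⟨x, hx⟩
        have hcx := Submodule.smul_mem _ c hx
        have h := (E.tendsto_integralVec hφ hx).const_smul c
        refine tendsto_nhds_unique (E.tendsto_integralVec hφ hcx) ?_
        simpa using h }

theorem memLp_of_bounded (E : ProjValuedMeasure H) {φ : ℝ → ℂ} (hφ : Measurable φ)
    (hb : ∃ C : ℝ, ∀ t, ‖φ t‖ ≤ C) (x : H) : MemLp φ 2 (E.scalarMeasure x) := by
  obtain ⟨C, hC⟩ := hb
  exact MemLp.of_bound hφ.aestronglyMeasurable C (Eventually.of_forall hC)

theorem norm_integralVec_le (E : ProjValuedMeasure H) {φ : ℝ → ℂ} (hφ : Measurable φ) {C : ℝ}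
    (hC : ∀ t, ‖φ t‖ ≤ C) (x : H) : ‖E.integralVec φ hφ x‖ ≤ C * ‖x‖ := by
  have hC0 : 0 ≤ C := (norm_nonneg _).trans (hC 0)
  have h := E.enorm_integralVec hφ (E.memLp_of_bounded hφ ⟨C, hC⟩ x)
  have h2 := eLpNorm_le_of_ae_bound (p := 2) (μ := E.scalarMeasure x) (Eventually.of_forall hC)
  rw [← h, scalarMeasure_univ, ENNReal.ofReal_pow (norm_nonneg _), ← ENNReal.rpow_two,
    ← ENNReal.rpow_mul] at h2
  norm_num at h2
  rw [← ofReal_norm, ← ofReal_norm, ← ENNReal.ofReal_mul (norm_nonneg _),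
    ENNReal.ofReal_le_ofReal_iff (by positivity)] at h2
  linarith

/-- For a bounded Borel function `φ`, the everywhere defined bounded operator `∫ φ dE`. -/
noncomputable def boundedIntegral (E : ProjValuedMeasure H) (φ : ℝ → ℂ) (hφ : Measurable φ)
    (hb : ∃ C : ℝ, ∀ t, ‖φ t‖ ≤ C) : H →L[ℂ] H :=
  LinearMap.mkContinuousOfExistsBound
    { toFun := fun x => E.integral φ hφ ⟨x, E.memLp_of_bounded hφ hb x⟩
      map_add' := fun x y => (E.integral φ hφ).map_add
        ⟨x, E.memLp_of_bounded hφ hb x⟩ ⟨y, E.memLp_of_bounded hφ hb y⟩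
      map_smul' := fun c x => (E.integral φ hφ).map_smul c ⟨x, E.memLp_of_bounded hφ hb x⟩ }
    (by
      obtain ⟨C, hC⟩ := hb
      exact ⟨C, fun x => E.norm_integralVec_le hφ hC x⟩)

/-- The Dirac projection-valued measure at `0`. -/
noncomputable instance : Inhabited (ProjValuedMeasure H) := by
  classical
  exact ⟨{
    proj := fun S => if MeasurableSet S ∧ (0 : ℝ) ∈ S then 1 else 0
    isStarProjection := by
      intro S _
      split_ifs
      · exact IsStarProjection.one _
      · exact IsStarProjection.zero _
    proj_of_not_measurable := fun S hS => if_neg fun h => hS h.1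
    proj_univ := by simp
    proj_inter := by
      intro S T hS hT
      by_cases h1 : (0 : ℝ) ∈ S <;> by_cases h2 : (0 : ℝ) ∈ T <;> simp [h1, h2, hS, hT]
    hasSum_iUnion := by
      intro S hS hd x
      by_cases h : ∃ n, (0 : ℝ) ∈ S n
      · obtain ⟨n, hn⟩ := h
        have hU : (0 : ℝ) ∈ ⋃ n, S n := Set.mem_iUnion.2 ⟨n, hn⟩
        rw [if_pos ⟨MeasurableSet.iUnion hS, hU⟩]
        have h3 : HasSum (fun m => (if MeasurableSet (S m) ∧ (0 : ℝ) ∈ S m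
            then (1 : H →L[ℂ] H) else 0) x)
            ((if MeasurableSet (S n) ∧ (0 : ℝ) ∈ S n then (1 : H →L[ℂ] H) else 0) x) := by
          refine hasSum_single n fun m hm => ?_
          have : (0 : ℝ) ∉ S m := fun h0 => Set.disjoint_left.1 (hd hm) h0 hn
          simp [this]
        rwa [if_pos (⟨hS n, hn⟩ : MeasurableSet (S n) ∧ (0 : ℝ) ∈ S n)] at h3
      · have hU : (0 : ℝ) ∉ ⋃ n, S n := fun h0 => h (Set.mem_iUnion.1 h0)
        have h' : ∀ n, (0 : ℝ) ∉ S n := fun n hn => h ⟨n, hn⟩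
        simp only [h', hU, and_false, if_false, _root_.zero_apply]
        exact hasSum_zero }⟩

end ProjValuedMeasure

section FunctionalCalculus

variable {H : Type*} [NormedAddCommGroup H] [InnerProductSpace ℂ H] [CompleteSpace H]

open Classical in
/-- The spectral measure of a self-adjoint operator `A`: the unique projection-valued measure `E`
with `A = ∫ t dE(t)`, domains included (it exists by the spectral theorem; the Dirac measure at `0`
is a default value for operators that are not self-adjoint). -/
noncomputable def spectralMeasureOf (A : H →ₗ.[ℂ] H) : ProjValuedMeasure H :=
  if h : ∃ E : ProjValuedMeasure H, E.integral (fun t => (t : ℂ)) Complex.measurable_ofReal = A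
  then h.choose else default

/-- The operator `φ(A)`, for a Borel function `φ`, with its natural domain. -/
noncomputable def borelCalculus (A : H →ₗ.[ℂ] H) (φ : ℝ → ℂ) (hφ : Measurable φ) : H →ₗ.[ℂ] H :=
  (spectralMeasureOf A).integral φ hφ

/-- The bounded operator `φ(A)`, for a bounded Borel function `φ`. -/
noncomputable def boundedBorelCalculus (A : H →ₗ.[ℂ] H) (φ : ℝ → ℂ) (hφ : Measurable φ)
    (hb : ∃ C : ℝ, ∀ t, ‖φ t‖ ≤ C) : H →L[ℂ] H :=
  (spectralMeasureOf A).boundedIntegral φ hφ hb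

/-- The function `t ↦ ⟨t⟩ ^ r = (1 + t²) ^ (r / 2)`. -/
noncomputable def japaneseBracketPow (r : ℝ) (t : ℝ) : ℂ :=
  (((1 + t ^ 2) ^ (r / 2) : ℝ) : ℂ)

theorem measurable_japaneseBracketPow (r : ℝ) : Measurable (japaneseBracketPow r) := by
  unfold japaneseBracketPow
  fun_prop

theorem japaneseBracketPow_neg_bounded (s : ℝ≥0) :
    ∃ C : ℝ, ∀ t, ‖japaneseBracketPow (-(s : ℝ)) t‖ ≤ C := by
  refine ⟨1, fun t => ?_⟩
  have h1 : (1 : ℝ) ≤ 1 + t ^ 2 := by nlinarith [sq_nonneg t]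
  unfold japaneseBracketPow
  rw [Complex.norm_real, Real.norm_of_nonneg (by positivity)]
  exact Real.rpow_le_one_of_one_le_of_nonpos h1 (by have := s.2; linarith)

/-- `⟨A⟩ ^ s` as an operator with its natural domain. -/
noncomputable def bracketPow (A : H →ₗ.[ℂ] H) (s : ℝ≥0) : H →ₗ.[ℂ] H :=
  borelCalculus A (japaneseBracketPow s) (measurable_japaneseBracketPow s)

/-- `⟨A⟩ ^ (-s)` for `s ≥ 0`, as a bounded operator. -/
noncomputable def bracketPowNeg (A : H →ₗ.[ℂ] H) (s : ℝ≥0) : H →L[ℂ] H :=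
  boundedBorelCalculus A (japaneseBracketPow (-(s : ℝ))) (measurable_japaneseBracketPow _)
    (japaneseBracketPow_neg_bounded s)

/-- `(f n, z n)` is a special sequence for the operator `T` associated to `(I, s, A)`. The vector
`g n` is `(T - z n) (f n)`, as an element of the domain of `⟨A⟩ ^ s`; `l` is the limit of
`Re (z n)` and `η` is the mass. -/
def IsSpecialSequence (T : H →ₗ.[ℂ] H) (I : Set ℝ) (s : ℝ≥0) (A : H →ₗ.[ℂ] H)
    (f : ℕ → T.domain) (z : ℕ → ℂ) : Prop :=
  ∃ l ∈ I, ∃ η : ℝ, 0 ≤ η ∧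
    (∀ n, (z n).re ∈ I) ∧ Tendsto (fun n => (z n).re) atTop (𝓝 l) ∧
    (∀ n, (z n).im ≠ 0) ∧ Tendsto (fun n => (z n).im) atTop (𝓝 0) ∧
    Tendsto (fun n => ‖bracketPowNeg A s (f n : H)‖) atTop (𝓝 η) ∧
    ∃ g : ℕ → (bracketPow A s).domain, (∀ n, (g n : H) = T (f n) - z n • (f n : H)) ∧
      Tendsto (fun n => ‖bracketPow A s (g n)‖) atTop (𝓝 0)

end FunctionalCalculus

/-! Put `g = (Hb - z) f`. Self-adjointness of `Hb` turns the expectation of the commutator with `B =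
φ(A)` into `⟨g, B f⟩ - ⟨f, B g⟩ - 2i (Im z) ⟨f, B f⟩` (`inner_commutator_of_eq_add`). The difficulty
is that `‖f n‖` may be unbounded: only `‖⟨A⟩^(-s) f n‖` is controlled.

The first two terms are harmless because `B` commutes with the weight: insert `g = ⟨A⟩^(-s) ⟨A⟩^s g`
and move `⟨A⟩^(-s)` across the inner product, so each is at most `sup |φ|` times `‖⟨A⟩^(-s) f‖
‖⟨A⟩^s g‖`, which tends to `η · 0`. In the last term, `⟨f, Hb f⟩` is real, hence `|Im z| ‖f‖² = |Im
⟨f, g⟩|`, and the same weighted Cauchy–Schwarz inequality applies (`abs_im_mul_norm_sq_le`,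
`norm_inner_le_bracketPow`).

What remains is functional calculus: commutation and symmetry of bounded spectral integrals, and
`⟨A⟩^(-s) ⟨A⟩^s g = g` on the domain of `⟨A⟩^s`. Each is checked on simple functions and carried to
the limit by the isometry with `L²` of the scalar spectral measure. -/

namespace ProjValuedMeasure

variable {H : Type*} [NormedAddCommGroup H] [InnerProductSpace ℂ H] [CompleteSpace H]

/-! ### Algebra of spectral integrals of simple functions. -/

theorem simpleIntegral_add (E : ProjValuedMeasure H) (s t : SimpleFunc ℝ ℂ) :
    E.simpleIntegral (s + t) = E.simpleIntegral s + E.simpleIntegral t := by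
  ext x
  have h := E.simpleIntegral_sub (s + t) t x
  rw [add_sub_cancel_right] at h
  simp [h]

theorem simpleIntegral_indicator (E : ProjValuedMeasure H) (c : ℂ) {S : Set ℝ}
    (hS : MeasurableSet S) :
    E.simpleIntegral (SimpleFunc.piecewise S hS (SimpleFunc.const ℝ c) (SimpleFunc.const ℝ 0))
      = c • E.proj S := by
  ext x
  let T : Set ℝ → ℂ →L[ℝ] H := fun S =>
    (ContinuousLinearMap.toSpanSingleton ℂ (E.proj S x)).restrictScalars ℝ
  have hT : T ∅ = 0 := by
    ext
    simp [T, E.proj_empty]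
  have h := SimpleFunc.setToSimpleFunc_indicator T hT hS c
  simpa [simpleIntegral, SimpleFunc.setToSimpleFunc, T] using h

theorem simpleIntegral_const (E : ProjValuedMeasure H) (c : ℂ) :
    E.simpleIntegral (SimpleFunc.const ℝ c) = c • 1 := by
  rw [← E.proj_univ, ← E.simpleIntegral_indicator c MeasurableSet.univ]
  congr 1
  ext
  simp

/-- Additivity in each factor reduces this to indicators, where it is `E(S ∩ T) = E(S) E(T)`. -/
theorem simpleIntegral_mul (E : ProjValuedMeasure H) (s t : SimpleFunc ℝ ℂ) :
    E.simpleIntegral (s * t) = E.simpleIntegral s * E.simpleIntegral t := by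
  induction s using SimpleFunc.induction with
  | add _ hf hg => simp only [add_mul, simpleIntegral_add, hf, hg]
  | @const c S hS =>
    induction t using SimpleFunc.induction with
    | add _ hf hg => simp only [mul_add, simpleIntegral_add, hf, hg]
    | @const d T hT =>
      have h : SimpleFunc.piecewise S hS (SimpleFunc.const ℝ c) (SimpleFunc.const ℝ 0) *
          SimpleFunc.piecewise T hT (SimpleFunc.const ℝ d) (SimpleFunc.const ℝ 0) =
          SimpleFunc.piecewise (S ∩ T) (hS.inter hT) (SimpleFunc.const ℝ (c * d))
            (SimpleFunc.const ℝ 0) := by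
        ext r
        by_cases h1 : r ∈ S <;> by_cases h2 : r ∈ T <;> simp [h1, h2]
      rw [h]
      simp only [simpleIntegral_indicator, E.proj_inter S T hS hT, smul_mul_smul_comm]

theorem adjoint_simpleIntegral (E : ProjValuedMeasure H) (s : SimpleFunc ℝ ℂ) :
    star (E.simpleIntegral s) = E.simpleIntegral (s.map star) := by
  induction s using SimpleFunc.induction with
  | @add f g _ hf hg =>
    have h : (f + g).map star = f.map star + g.map star := by
      ext r
      simp
    rw [h, simpleIntegral_add, simpleIntegral_add, star_add, hf, hg]
  | @const c S hS =>
    have h : (SimpleFunc.piecewise S hS (SimpleFunc.const ℝ c) (SimpleFunc.const ℝ 0)).map star =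
        SimpleFunc.piecewise S hS (SimpleFunc.const ℝ (star c)) (SimpleFunc.const ℝ 0) := by
      ext r
      by_cases h1 : r ∈ S <;> simp [h1]
    rw [h, simpleIntegral_indicator, simpleIntegral_indicator, star_smul,
      (E.isStarProjection S hS).isSelfAdjoint.star_eq]

/-! ### Bounded Borel functions: commutation and symmetry. -/

/-- Limit of the isometry for simple functions. It allows any simple functions converging to `φ` in
`L²`, not only `approx`, to compute the integral. -/
theorem enorm_simpleIntegral_sub_integralVec_le (E : ProjValuedMeasure H) {φ : ℝ → ℂ}
    (hφ : Measurable φ) {x : H} (h : MemLp φ 2 (E.scalarMeasure x)) (s : SimpleFunc ℝ ℂ) :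
    ‖E.simpleIntegral s x - E.integralVec φ hφ x‖ₑ ≤ eLpNorm (⇑s - φ) 2 (E.scalarMeasure x) := by
  have h1 := ((tendsto_const_nhds (x := E.simpleIntegral s x)).sub
    (E.tendsto_integralVec hφ h)).enorm
  have h2 := (tendsto_const_nhds (x := eLpNorm (⇑s - φ) 2 (E.scalarMeasure x))).add
    (tendsto_eLpNorm_approx hφ h)
  rw [add_zero] at h2
  refine le_of_tendsto_of_tendsto' h1 h2 fun n => ?_
  rw [← E.simpleIntegral_sub, enorm_simpleIntegral]
  have h3 : (⇑(s - approx φ hφ n) : ℝ → ℂ) = (⇑s - φ) - (⇑(approx φ hφ n) - φ) := by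
    ext t
    simp
  rw [h3]
  exact eLpNorm_sub_le (s.measurable.sub hφ).aestronglyMeasurable
    ((SimpleFunc.measurable _).sub hφ).aestronglyMeasurable (by norm_num)

theorem tendsto_boundedIntegral (E : ProjValuedMeasure H) {φ : ℝ → ℂ} (hφ : Measurable φ)
    (hb : ∃ C : ℝ, ∀ t, ‖φ t‖ ≤ C) (x : H) :
    Tendsto (fun n => E.simpleIntegral (approx φ hφ n) x) atTop
      (𝓝 (E.boundedIntegral φ hφ hb x)) :=
  E.tendsto_integralVec hφ (E.memLp_of_bounded hφ hb x)

theorem norm_boundedIntegral_le (E : ProjValuedMeasure H) {φ : ℝ → ℂ} (hφ : Measurable φ)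
    {C : ℝ} (hC : ∀ t, ‖φ t‖ ≤ C) (x : H) :
    ‖E.boundedIntegral φ hφ ⟨C, hC⟩ x‖ ≤ C * ‖x‖ :=
  E.norm_integralVec_le hφ hC x

theorem simpleIntegral_commute_boundedIntegral (E : ProjValuedMeasure H) {φ : ℝ → ℂ}
    (hφ : Measurable φ) (hb : ∃ C : ℝ, ∀ t, ‖φ t‖ ≤ C) (s : SimpleFunc ℝ ℂ) :
    Commute (E.simpleIntegral s) (E.boundedIntegral φ hφ hb) := by
  ext x
  refine tendsto_nhds_unique (((E.simpleIntegral s).continuous.tendsto _).comp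
    (E.tendsto_boundedIntegral hφ hb x)) ?_
  refine (E.tendsto_boundedIntegral hφ hb (E.simpleIntegral s x)).congr fun n => ?_
  have h := DFunLike.congr_fun ((E.simpleIntegral_mul (approx φ hφ n) s).symm.trans
    ((congrArg E.simpleIntegral (mul_comm _ _)).trans
      (E.simpleIntegral_mul s (approx φ hφ n)))) x
  exact h

/-- Simple functions commute pointwise, hence so do their integrals; the limit is taken in one
factor at a time. -/
theorem boundedIntegral_commute (E : ProjValuedMeasure H) {φ ψ : ℝ → ℂ}
    (hφ : Measurable φ) (hb : ∃ C : ℝ, ∀ t, ‖φ t‖ ≤ C)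
    (hψ : Measurable ψ) (hb' : ∃ C : ℝ, ∀ t, ‖ψ t‖ ≤ C) :
    Commute (E.boundedIntegral φ hφ hb) (E.boundedIntegral ψ hψ hb') := by
  ext x
  refine tendsto_nhds_unique (E.tendsto_boundedIntegral hφ hb _) ?_
  refine (((E.boundedIntegral ψ hψ hb').continuous.tendsto _).comp
    (E.tendsto_boundedIntegral hφ hb x)).congr fun n => ?_
  exact (DFunLike.congr_fun
    (E.simpleIntegral_commute_boundedIntegral hψ hb' (approx φ hφ n)) x).symm

theorem inner_boundedIntegral_left (E : ProjValuedMeasure H) {φ : ℝ → ℂ} (hφ : Measurable φ)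
    (hb : ∃ C : ℝ, ∀ t, ‖φ t‖ ≤ C) (hreal : ∀ t, star (φ t) = φ t) (x y : H) :
    inner ℂ (E.boundedIntegral φ hφ hb x) y = inner ℂ x (E.boundedIntegral φ hφ hb y) := by
  have hy := E.memLp_of_bounded hφ hb y
  -- As `φ` is real, the conjugated approximants are as close to `φ` in `L²` as the original ones.
  have h0 : Tendsto (fun n => E.simpleIntegral ((approx φ hφ n).map star) y) atTop
      (𝓝 (E.boundedIntegral φ hφ hb y)) := by
    rw [tendsto_iff_edist_tendsto_0]
    refine tendsto_of_tendsto_of_tendsto_of_le_of_le tendsto_const_nhds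
      (tendsto_eLpNorm_approx hφ hy) (fun _ => zero_le) fun n => ?_
    rw [edist_eq_enorm_sub]
    refine (E.enorm_simpleIntegral_sub_integralVec_le hφ hy _).trans (le_of_eq ?_)
    refine eLpNorm_congr_norm_ae (Eventually.of_forall fun t => ?_)
    simp only [Pi.sub_apply, SimpleFunc.map_apply]
    rw [← norm_star, star_sub, star_star, hreal]
  refine tendsto_nhds_unique ((E.tendsto_boundedIntegral hφ hb x).inner tendsto_const_nhds)
    ((tendsto_const_nhds.inner h0).congr fun n => ?_)
  rw [← adjoint_simpleIntegral, ContinuousLinearMap.star_eq_adjoint,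
    ContinuousLinearMap.adjoint_inner_right]

/-! ### Inverting an unbounded spectral integral. -/

theorem enorm_sub_simpleIntegral_integralVec_le (E : ProjValuedMeasure H) {ψ : ℝ → ℂ}
    (hψ : Measurable ψ) {x : H} (h : MemLp ψ 2 (E.scalarMeasure x)) (s : SimpleFunc ℝ ℂ) :
    ‖x - E.simpleIntegral s (E.integralVec ψ hψ x)‖ₑ
      ≤ eLpNorm (fun t => 1 - s t * ψ t) 2 (E.scalarMeasure x) := by
  -- A simple function is bounded; `C` controls the cost of replacing `ψ` by its approximants after
  -- multiplication by `s`.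
  obtain ⟨C, hC⟩ := s.exists_forall_norm_le
  have h1 := ((tendsto_const_nhds (x := x)).sub
    (((E.simpleIntegral s).continuous.tendsto _).comp (E.tendsto_integralVec hψ h))).enorm
  have h2 := (tendsto_const_nhds (x := eLpNorm (fun t => 1 - s t * ψ t) 2
    (E.scalarMeasure x))).add (ENNReal.Tendsto.const_mul (a := ENNReal.ofReal C)
      (tendsto_eLpNorm_approx hψ h) (Or.inr ENNReal.ofReal_ne_top))
  rw [mul_zero, add_zero] at h2
  refine le_of_tendsto_of_tendsto' h1 h2 fun n => ?_
  have h3 : x - E.simpleIntegral s (E.simpleIntegral (approx ψ hψ n) x)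
      = E.simpleIntegral (SimpleFunc.const ℝ 1 - s * approx ψ hψ n) x := by
    rw [simpleIntegral_sub, simpleIntegral_mul, simpleIntegral_const]
    simp
  have h4 : (⇑(SimpleFunc.const ℝ (1 : ℂ) - s * approx ψ hψ n) : ℝ → ℂ)
      = (fun t => 1 - s t * ψ t) - (fun t => s t * (approx ψ hψ n t - ψ t)) := by
    ext t
    simp only [SimpleFunc.coe_sub, SimpleFunc.coe_const, SimpleFunc.coe_mul, Pi.sub_apply,
      Function.const_apply, Pi.mul_apply]
    ring
  have hm := (approx ψ hψ n).measurable.sub hψ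
  simp only [Function.comp_apply]
  rw [h3, enorm_simpleIntegral, h4]
  refine (eLpNorm_sub_le (measurable_const.sub (s.measurable.mul hψ)).aestronglyMeasurable
    (s.measurable.mul hm).aestronglyMeasurable (by norm_num)).trans ?_
  have h5 : ∀ t, ‖s t * (approx ψ hψ n t - ψ t)‖ ≤ C * ‖(⇑(approx ψ hψ n) - ψ) t‖ := by
    intro t
    rw [norm_mul]
    exact mul_le_mul_of_nonneg_right (hC t) (norm_nonneg _)
  exact add_le_add le_rfl (eLpNorm_le_mul_eLpNorm_of_ae_le_mul (Eventually.of_forall h5) 2)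

theorem tendsto_eLpNorm_one_sub_approx_mul {μ : Measure ℝ} [IsFiniteMeasure μ] {φ ψ : ℝ → ℂ}
    (hφ : Measurable φ) (hψ : Measurable ψ) (hφψ : ∀ t, φ t * ψ t = 1) :
    Tendsto (fun n => eLpNorm (fun t => 1 - approx φ hφ n t * ψ t) 2 μ) atTop (𝓝 0) := by
  -- The approximants satisfy `|approx φ| ≤ 2 |φ|`, and `|φ ψ| = 1`, so the bound is `1 + 2`. This
  -- gives a constant dominating function even when `ψ` is unbounded.
  have hle : ∀ n t, ‖1 - approx φ hφ n t * ψ t‖ ≤ 3 := by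
    intro n t
    have h1 := SimpleFunc.norm_approxOn_zero_le hφ (Set.mem_univ 0) t n
    have h2 : ‖φ t‖ * ‖ψ t‖ = 1 := by rw [← norm_mul, hφψ, norm_one]
    refine (norm_sub_le _ _).trans ?_
    rw [norm_one, norm_mul]
    have h3 := mul_le_mul_of_nonneg_right h1 (norm_nonneg (ψ t))
    change ‖approx φ hφ n t‖ * ‖ψ t‖ ≤ _ at h3
    linarith
  have hm : ∀ n, Measurable fun t => 1 - approx φ hφ n t * ψ t :=
    fun n => measurable_const.sub ((SimpleFunc.measurable _).mul hψ)
  have h := tendsto_lintegral_of_dominated_convergence (μ := μ)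
    (F := fun n t => ‖1 - approx φ hφ n t * ψ t‖ₑ ^ (2 : ℝ)) (f := fun _ => 0)
    (fun _ => ENNReal.ofReal 3 ^ (2 : ℝ)) (fun n => (hm n).enorm.pow_const _)
    (fun n => Eventually.of_forall fun t => by
      refine ENNReal.rpow_le_rpow ?_ (by norm_num)
      rw [← ofReal_norm]
      exact ENNReal.ofReal_le_ofReal (hle n t))
    (by
      rw [lintegral_const]
      exact ENNReal.mul_ne_top (ENNReal.rpow_ne_top_of_nonneg (by norm_num) ENNReal.ofReal_ne_top)
        (measure_ne_top _ _))
    (Eventually.of_forall fun t => by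
      have h1 : Tendsto (fun n => approx φ hφ n t) atTop (𝓝 (φ t)) :=
        SimpleFunc.tendsto_approxOn hφ (Set.mem_univ 0) (by simp)
      have h2 := ((tendsto_const_nhds (x := (1 : ℂ))).sub (h1.mul_const (ψ t))).enorm
      rw [hφψ, sub_self, enorm_zero] at h2
      simpa using h2.ennrpow_const 2)
  rw [lintegral_zero] at h
  have h' := h.ennrpow_const (1 / 2)
  rw [ENNReal.zero_rpow_of_pos (by norm_num)] at h'
  refine h'.congr fun n => ?_
  rw [eLpNorm_eq_lintegral_rpow_enorm_toReal (by norm_num) (by norm_num)]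
  simp

theorem boundedIntegral_integralVec (E : ProjValuedMeasure H) {φ ψ : ℝ → ℂ} (hφ : Measurable φ)
    (hb : ∃ C : ℝ, ∀ t, ‖φ t‖ ≤ C) (hψ : Measurable ψ) (hφψ : ∀ t, φ t * ψ t = 1) {x : H}
    (h : MemLp ψ 2 (E.scalarMeasure x)) :
    E.boundedIntegral φ hφ hb (E.integralVec ψ hψ x) = x := by
  refine tendsto_nhds_unique (E.tendsto_boundedIntegral hφ hb _) ?_
  rw [tendsto_iff_edist_tendsto_0]
  refine tendsto_of_tendsto_of_tendsto_of_le_of_le tendsto_const_nhds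
    (tendsto_eLpNorm_one_sub_approx_mul hφ hψ hφψ (μ := E.scalarMeasure x))
    (fun _ => zero_le) fun n => ?_
  rw [edist_comm, edist_eq_enorm_sub]
  exact E.enorm_sub_simpleIntegral_integralVec_le hψ h _

end ProjValuedMeasure

/-! ### Weighted estimates and the commutator identity. -/

theorem japaneseBracketPow_neg_mul (r t : ℝ) :
    japaneseBracketPow (-r) t * japaneseBracketPow r t = 1 := by
  have h : (0 : ℝ) < 1 + t ^ 2 := by positivity
  unfold japaneseBracketPow
  rw [← Complex.ofReal_mul, ← Real.rpow_add h, neg_div, neg_add_cancel, Real.rpow_zero,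
    Complex.ofReal_one]

section VirialEstimate

variable {H : Type*} [NormedAddCommGroup H] [InnerProductSpace ℂ H] [CompleteSpace H]

theorem bracketPowNeg_bracketPow (A : H →ₗ.[ℂ] H) (s : ℝ≥0) (g : (bracketPow A s).domain) :
    bracketPowNeg A s (bracketPow A s g) = g :=
  (spectralMeasureOf A).boundedIntegral_integralVec _
    (japaneseBracketPow_neg_bounded s) _ (japaneseBracketPow_neg_mul s) g.2

theorem inner_bracketPowNeg_left (A : H →ₗ.[ℂ] H) (s : ℝ≥0) (x y : H) :
    inner ℂ (bracketPowNeg A s x) y = inner ℂ x (bracketPowNeg A s y) :=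
  (spectralMeasureOf A).inner_boundedIntegral_left _
    (japaneseBracketPow_neg_bounded s)
    (fun _ => Complex.conj_ofReal _) x y

theorem bracketPowNeg_boundedBorelCalculus (A : H →ₗ.[ℂ] H) (s : ℝ≥0) {φ : ℝ → ℂ}
    (hφ : Measurable φ) (hb : ∃ C : ℝ, ∀ t, ‖φ t‖ ≤ C) (x : H) :
    bracketPowNeg A s (boundedBorelCalculus A φ hφ hb x)
      = boundedBorelCalculus A φ hφ hb (bracketPowNeg A s x) :=
  DFunLike.congr_fun ((spectralMeasureOf A).boundedIntegral_commute
    (measurable_japaneseBracketPow _) (japaneseBracketPow_neg_bounded s) hφ hb) x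

/-- Cauchy–Schwarz in the duality between the weights `⟨A⟩^(-s)` and `⟨A⟩^s`; `x` enters only
through its weighted norm. -/
theorem norm_inner_le_bracketPow (A : H →ₗ.[ℂ] H) (s : ℝ≥0) (x : H)
    (g : (bracketPow A s).domain) :
    ‖inner ℂ x (g : H)‖ ≤ ‖bracketPowNeg A s x‖ * ‖bracketPow A s g‖ := by
  rw [← bracketPowNeg_bracketPow A s g, ← inner_bracketPowNeg_left]
  exact norm_inner_le_norm _ _

theorem norm_inner_boundedBorelCalculus_left_le (A : H →ₗ.[ℂ] H) (s : ℝ≥0) {φ : ℝ → ℂ}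
    (hφ : Measurable φ) {C : ℝ} (hC : ∀ t, ‖φ t‖ ≤ C) (x : H) (g : (bracketPow A s).domain) :
    ‖inner ℂ (boundedBorelCalculus A φ hφ ⟨C, hC⟩ x) (g : H)‖
      ≤ C * (‖bracketPowNeg A s x‖ * ‖bracketPow A s g‖) := by
  refine (norm_inner_le_bracketPow A s _ g).trans ?_
  rw [bracketPowNeg_boundedBorelCalculus, ← mul_assoc]
  gcongr
  exact (spectralMeasureOf A).norm_boundedIntegral_le hφ hC _

/-- Writing `g` as `⟨A⟩^(-s) ⟨A⟩^s g` before commuting avoids having to show that `φ(A) g` lies in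
the domain of `⟨A⟩^s`. -/
theorem norm_inner_boundedBorelCalculus_right_le (A : H →ₗ.[ℂ] H) (s : ℝ≥0) {φ : ℝ → ℂ}
    (hφ : Measurable φ) {C : ℝ} (hC : ∀ t, ‖φ t‖ ≤ C) (x : H) (g : (bracketPow A s).domain) :
    ‖inner ℂ x (boundedBorelCalculus A φ hφ ⟨C, hC⟩ (g : H))‖
      ≤ C * (‖bracketPowNeg A s x‖ * ‖bracketPow A s g‖) := by
  rw [← bracketPowNeg_bracketPow A s g, ← bracketPowNeg_boundedBorelCalculus,
    ← inner_bracketPowNeg_left, mul_left_comm]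
  refine (norm_inner_le_norm _ _).trans ?_
  gcongr
  exact (spectralMeasureOf A).norm_boundedIntegral_le hφ hC _

/-- Substitute `T x = g + z x` on both sides of the commutator: the terms in `z` leave the factor
`conj z - z = -2i Im z`. -/
theorem inner_commutator_of_eq_add {T B : H →L[ℂ] H} (hT : IsSelfAdjoint T) {x g : H} {z : ℂ}
    (hg : g = T x - z • x) :
    inner ℂ x (⁅T, B⁆ x) = inner ℂ g (B x) - inner ℂ x (B g)
      - 2 * Complex.I * z.im * inner ℂ x (B x) := by
  have h1 : T x = g + z • x := by rw [hg]; abel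
  have h2 : inner ℂ x (T (B x)) = inner ℂ (T x) (B x) := by
    rw [← ContinuousLinearMap.adjoint_inner_left, ContinuousLinearMap.isSelfAdjoint_iff'.1 hT]
  have h3 : starRingEnd ℂ z = z - 2 * Complex.I * z.im := by
    apply Complex.ext <;> simp
    ring
  rw [Ring.lie_def, _root_.sub_apply, mul_apply_eq_comp, mul_apply_eq_comp, inner_sub_right, h2,
    h1, map_add, map_smul, inner_add_left, inner_add_right, inner_smul_left, inner_smul_right, h3]
  ring

/-- Since `⟨x, T x⟩` is real, `Im ⟨x, g⟩ = -(Im z) ‖x‖²`. This compensates for the absence of a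
bound on `‖x‖`. -/
theorem abs_im_mul_norm_sq_le {T : H →L[ℂ] H} (hT : IsSelfAdjoint T) {x g : H} {z : ℂ}
    (hg : g = T x - z • x) : |z.im| * ‖x‖ ^ 2 ≤ ‖inner ℂ x g‖ := by
  have h1 : (inner ℂ x (T x)).im = 0 := by
    have h := hT.isSymmetric.im_inner_apply_self x
    rw [← inner_conj_symm, Complex.conj_im, neg_eq_zero]
    exact h
  have h2 : (inner ℂ x g).im = -(z.im * ‖x‖ ^ 2) := by
    rw [hg, inner_sub_right, inner_smul_right, inner_self_eq_norm_sq_to_K, Complex.sub_im, h1]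
    simp [← Complex.ofReal_pow]
  have h3 := Complex.abs_im_le_norm (inner ℂ x g)
  rwa [h2, abs_neg, abs_mul, abs_of_nonneg (sq_nonneg ‖x‖)] at h3

end VirialEstimate

/-- Virial-like theorem. -/
theorem proposition2 {H : Type*} [NormedAddCommGroup H] [InnerProductSpace ℂ H] [CompleteSpace H]
    (A : H →ₗ.[ℂ] H) (hA : IsSelfAdjoint A)
    (Hb : H →L[ℂ] H) (hHb : IsSelfAdjoint Hb)
    (I : Set ℝ) (hI : I.OrdConnected) (hIb : Bornology.IsBounded I) (s : ℝ≥0)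
    (f : ℕ → ((Hb : H →ₗ[ℂ] H).toPMap ⊤).domain) (z : ℕ → ℂ)
    (hf : IsSpecialSequence ((Hb : H →ₗ[ℂ] H).toPMap ⊤) I s A f z)
    (φ : ℝ → ℂ) (hφ : Measurable φ) (hφb : ∃ C : ℝ, ∀ t, ‖φ t‖ ≤ C) :
    Tendsto (fun n => inner ℂ (f n : H) (⁅Hb, boundedBorelCalculus A φ hφ hφb⁆ (f n : H)))
      atTop (𝓝 0) := by
  obtain ⟨l, -, η, -, -, -, -, -, hW, g, hg, hG⟩ := hf
  obtain ⟨C, hC⟩ := hφb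
  have hC0 : 0 ≤ C := (norm_nonneg _).trans (hC 0)
  -- The constant is `C + C + 2 * C`, one summand for each term of the commutator identity.
  have hlim := (hW.mul hG).const_mul (4 * C)
  rw [mul_zero, mul_zero] at hlim
  refine squeeze_zero_norm (fun n => ?_) hlim
  have hgn : (g n : H) = Hb (f n) - z n • (f n : H) := hg n
  rw [inner_commutator_of_eq_add hHb hgn]
  have h1 := norm_inner_boundedBorelCalculus_left_le A s hφ hC (f n) (g n)
  have h2 := norm_inner_boundedBorelCalculus_right_le A s hφ hC (f n) (g n)
  have h3 : ‖2 * Complex.I * (z n).im * inner ℂ (f n : H)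
      (boundedBorelCalculus A φ hφ ⟨C, hC⟩ (f n))‖
      ≤ 2 * C * (‖bracketPowNeg A s (f n)‖ * ‖bracketPow A s (g n)‖) := by
    have h4 : ‖inner ℂ (f n : H) (boundedBorelCalculus A φ hφ ⟨C, hC⟩ (f n))‖
        ≤ C * ‖(f n : H)‖ ^ 2 := by
      refine (norm_inner_le_norm _ _).trans ?_
      have h := mul_le_mul_of_nonneg_left
        ((spectralMeasureOf A).norm_boundedIntegral_le hφ hC (f n : H)) (norm_nonneg (f n : H))
      refine h.trans (le_of_eq ?_)
      ring
    -- The factor `|Im z|` absorbs the possibly unbounded `‖f n‖²` left by the plain Cauchy–Schwarz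
    -- bound `h4`.
    have h5 := (abs_im_mul_norm_sq_le hHb hgn).trans (norm_inner_le_bracketPow A s (f n) (g n))
    rw [norm_mul, norm_mul, norm_mul, Complex.norm_I, Complex.norm_real, Real.norm_eq_abs,
      Complex.norm_two, mul_one]
    calc 2 * |(z n).im| * _ ≤ 2 * |(z n).im| * (C * ‖(f n : H)‖ ^ 2) := by gcongr
      _ = 2 * C * (|(z n).im| * ‖(f n : H)‖ ^ 2) := by ring
      _ ≤ _ := by gcongr
  rw [norm_inner_symm] at h1
  refine (norm_sub_le _ _).trans ((add_le_add (norm_sub_le _ _) h3).trans ?_)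
  linarith
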